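/- All graphs are finite and simple. Let $G$ be a graph with vertex set $\{1,\dots,n\}$ and at least one edge (for instance, any connected graph on $n\ge 2$ vertices). Let $\mathcal S(G)$ be the set of real symmetric $n\times n$ matrices $A=(a_{ij})$ such that, for all $i\ne j$, $a_{ij}\neq 0$ if and only if $ij$ is an edge of $G$ (the diagonal entries are arbitrary). The spark of a square real matrix $A$ is the smallest $s$ such that some $s$ columns of $A$ are linearly dependent; if $A$ is a nonsingular $n\times n$ matrix, $\operatorname{spark}(A)=n+1$. The vertex connectivity $\kappa(G)$ is the minimum size of a set of vertices whose deletion leaves a disconnected graph, with $\kappa(K_n)=n-1$ for the complete graph $K_n$; $G$ is called $m$-connected if $\kappa(G)\ge m$. Let $$\operatorname{mfsr}(G)=\min\{\operatorname{rank}(A) : A\in\mathcal S(G),\ \operatorname{spark}(A)=\operatorname{rank}(A)+1\},$$ and let $\operatorname{mfsr}_+(G)$ be the same minimum taken over the positive semidefinite matrices in $\mathcal S(G)$ only. Theorem. For every integer $k$ with $0\le k\le n$, the graph $G$ is $(n-k)$-connected if and only if there is a matrix $A\in\mathcal S(G)$ with $\operatorname{rank}(A)=k$ and $\operatorname{spark}(A)=k+1$.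 Moreover, $\operatorname{mfsr}(G)=\operatorname{mfsr}_+(G)=n-\kappa(G)$. -/

import Mathlib

/-- The spark of a square real matrix: the smallest `s` such that some `s` columns (counted by
index, so that two equal columns are dependent) are linearly dependent. If the matrix is
nonsingular, that is, if all its columns together are linearly independent, the spark is one more
than the number of columns. -/
noncomputable def Matrix.spark {V : Type*} [Fintype V] (A : Matrix V V ℝ) : ℕ :=
  open Classical in
  if LinearIndependent ℝ A.col then Fintype.card V + 1
  else sInf {s : ℕ | ∃ T : Finset V, T.card = s ∧ ¬ LinearIndepOn ℝ A.col (T : Set V)}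

namespace SimpleGraph

variable {V : Type*}

/-- `S(G)`: the real symmetric matrices whose graph is `G`; the diagonal is unrestricted. -/
def symmMatrices (G : SimpleGraph V) : Set (Matrix V V ℝ) :=
  {A | A.IsSymm ∧ ∀ i j, i ≠ j → (A i j ≠ 0 ↔ G.Adj i j)}

/-- A cut set of `G`: a set of vertices whose deletion leaves a disconnected graph. (Deleting all
vertices but one, or all vertices, does not disconnect.) -/
def IsCutSet (G : SimpleGraph V) (S : Finset V) : Prop :=
  ¬ (G.induce ((S : Set V)ᶜ)).Preconnected

/-- The vertex connectivity `κ(G)`: the minimum size of a cut set, and `n - 1` for a graph on `n`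
vertices without cut sets, that is, for a complete graph. -/
noncomputable def vertexConnectivity [Fintype V] (G : SimpleGraph V) : ℕ :=
  open Classical in
  if ∃ S : Finset V, G.IsCutSet S then sInf {m : ℕ | ∃ S : Finset V, G.IsCutSet S ∧ S.card = m}
  else Fintype.card V - 1

/-- `G` is `m`-connected if `κ(G) ≥ m`. -/
def IsVertexConnected [Fintype V] (G : SimpleGraph V) (m : ℕ) : Prop :=
  m ≤ G.vertexConnectivity

/-- The minimum full spark rank of `G`. -/
noncomputable def mfsr [Fintype V] (G : SimpleGraph V) : ℕ :=
  sInf {r : ℕ | ∃ A ∈ G.symmMatrices, A.spark = A.rank + 1 ∧ A.rank = r}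

/-- The minimum full spark rank of `G` over positive semidefinite matrices. -/
noncomputable def mfsrPos [Fintype V] (G : SimpleGraph V) : ℕ :=
  sInf {r : ℕ | ∃ A ∈ G.symmMatrices, A.PosSemidef ∧ A.spark = A.rank + 1 ∧ A.rank = r}

end SimpleGraph

/-! Both sides are equivalent to a condition (*): two nonempty disjoint vertex sets with no edges
between them have at most `k` vertices in total. For `k > 0` this is `(n-k)`-connectedness, since
the complement of the two sets is a cut set.

From a matrix to (*): if `B` and `C` violate (*), `k + 1` columns indexed in `B ∪ C` and meeting
both sets satisfy a linear relation. The zero blocks of `A` and its symmetry make the `B`-part and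
the `C`-part of the relation vanish separately; each has at most `k` terms, so the relation is
trivial (`Matrix.IsSymm.card_add_card_le_of_spark`).

From (*) to a matrix (Lovász, Saks and Schrijver): choose vectors in `ℝ^k` one vertex at a time,
each projected orthogonally to the earlier non-neighbours. Under (*) the generic properties of the
result do not depend on the order (`HoldsGenerically.perm`). So any `k` vertices may be treated
first, which gives independence, and so may any edge, which gives a nonzero product. The Gram matrix
of such vectors is positive semidefinite of rank `k` and spark `k + 1`, so it settles both minima.
-/

/-! ### Sequential orthogonal representations -/

section SequentialRepresentation

open Matrix Polynomial

variable {V ι : Type*} [Fintype ι] {R R' : Type*} [CommRing R] [CommRing R']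

/-- The Gram matrix of the vectors `f i`, `i ∈ S`. -/
def gramOn (f : V → ι → R) (S : Finset V) : Matrix S S R :=
  Matrix.of fun i j => f i ⬝ᵥ f j

theorem gramOn_map (φ : R →+* R') (f : V → ι → R) (S : Finset V) :
    gramOn (fun v i => φ (f v i)) S = (gramOn f S).map φ := by
  ext i j
  simp [gramOn, dotProduct]

theorem gramOn_congr {f g : V → ι → R} {S : Finset V} (h : ∀ v ∈ S, f v = g v) :
    gramOn f S = gramOn g S := by
  ext i j
  simp [gramOn, h i i.2, h j j.2]

/-- The component of `y` orthogonal to the vectors `f i`, `i ∈ S`, multiplied by the determinant of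
their Gram matrix. It is polynomial in all entries. -/
def scaledProj [DecidableEq V] (f : V → ι → R) (S : Finset V) (y : ι → R) : ι → R :=
  (gramOn f S).det • y - ∑ i : S, ((gramOn f S).adjugate *ᵥ fun j : S => f j ⬝ᵥ y) i • f i

variable [DecidableEq V]

/-- Only `M * adj M = det M • 1` is used, so orthogonality survives a singular Gram matrix and holds
over `ℝ[X]`. -/
theorem dotProduct_scaledProj (f : V → ι → R) {S : Finset V} (y : ι → R) {j : V} (hj : j ∈ S) :
    f j ⬝ᵥ scaledProj f S y = 0 := by
  have h : ((gramOn f S) *ᵥ ((gramOn f S).adjugate *ᵥ fun j : S => f j ⬝ᵥ y)) ⟨j, hj⟩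
      = (gramOn f S).det * (f j ⬝ᵥ y) := by
    rw [Matrix.mulVec_mulVec, Matrix.mul_adjugate, Matrix.smul_mulVec, Matrix.one_mulVec]
    simp
  rw [scaledProj, dotProduct_sub, dotProduct_smul, smul_eq_mul, ← h, dotProduct_sum, sub_eq_zero]
  simp only [dotProduct_smul, smul_eq_mul]
  rw [Matrix.mulVec, dotProduct]
  exact Finset.sum_congr rfl fun i _ => by rw [gramOn, Matrix.of_apply, mul_comm]

theorem scaledProj_of_orthogonal {f : V → ι → R} {S : Finset V} {y : ι → R}
    (h : ∀ j ∈ S, f j ⬝ᵥ y = 0) : scaledProj f S y = (gramOn f S).det • y := by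
  have : (fun j : S => f j ⬝ᵥ y) = 0 := funext fun j => h j j.2
  simp [scaledProj, this]

theorem scaledProj_empty (f : V → ι → R) (y : ι → R) : scaledProj f ∅ y = y := by
  rw [scaledProj_of_orthogonal (by simp), Matrix.det_isEmpty, one_smul]

theorem det_gramOn_map (φ : R →+* R') (f : V → ι → R) (S : Finset V) :
    (gramOn (fun v i => φ (f v i)) S).det = φ (gramOn f S).det := by
  rw [gramOn_map, RingHom.map_det, RingHom.mapMatrix_apply]

theorem scaledProj_map (φ : R →+* R') (f : V → ι → R) (S : Finset V) (y : ι → R) :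
    scaledProj (fun v i => φ (f v i)) S (fun i => φ (y i)) = fun i => φ (scaledProj f S y i) := by
  have hadj : ((gramOn f S).map φ).adjugate = (gramOn f S).adjugate.map φ := by
    have := RingHom.map_adjugate φ (gramOn f S)
    simpa [RingHom.mapMatrix_apply] using this.symm
  have hdet : ((gramOn f S).map φ).det = φ (gramOn f S).det := by
    rw [← gramOn_map, det_gramOn_map]
  ext i
  simp only [scaledProj, gramOn_map, hadj]
  simp [Matrix.mulVec, dotProduct, hdet]

theorem scaledProj_congr {f g : V → ι → R} {S : Finset V} (h : ∀ v ∈ S, f v = g v) (y : ι → R) :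
    scaledProj f S y = scaledProj g S y := by
  have h2 : ∀ i : S, f i = g i := fun i => h i i.2
  simp only [scaledProj, gramOn_congr h, h2]

variable (G : SimpleGraph V) [DecidableRel G.Adj]

/-- The sequential orthogonal representation of the subgraph induced on the list `l`, with
parameters `t`: from the end of the list to its head, `v` gets the scaled projection of `t v`
orthogonal to the vectors of the vertices already treated and not adjacent to `v`. -/
def seqRep : List V → (V → ι → R) → V → ι → R
  | [], _ => 0
  | v :: l, t => Function.update (seqRep l t) v
      (scaledProj (seqRep l t) (l.toFinset.filter fun w => ¬ G.Adj v w) (t v))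

variable {G}

theorem seqRep_cons_self (v : V) (l : List V) (t : V → ι → R) :
    seqRep G (v :: l) t v
      = scaledProj (seqRep G l t) (l.toFinset.filter fun w => ¬ G.Adj v w) (t v) := by
  simp [seqRep]

theorem seqRep_cons_of_ne {v w : V} (h : w ≠ v) (l : List V) (t : V → ι → R) :
    seqRep G (v :: l) t w = seqRep G l t w := by
  simp [seqRep, h]

theorem seqRep_of_notMem {w : V} {l : List V} (h : w ∉ l) (t : V → ι → R) :
    seqRep G l t w = 0 := by
  induction l with
  | nil => rfl
  | cons v l ih =>
    rw [List.mem_cons, not_or] at h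
    rw [seqRep_cons_of_ne h.1, ih h.2]

theorem seqRep_update_of_notMem {v : V} {l : List V} (h : v ∉ l) (t : V → ι → R) (y : ι → R) :
    seqRep G l (Function.update t v y) = seqRep G l t := by
  induction l with
  | nil => rfl
  | cons u l ih =>
    rw [List.mem_cons, not_or] at h
    rw [seqRep, seqRep, ih h.2, Function.update_of_ne (Ne.symm h.1)]

theorem seqRep_append_of_notMem {w : V} {l₁ : List V} (h : w ∉ l₁) (l₂ : List V) (t : V → ι → R) :
    seqRep G (l₁ ++ l₂) t w = seqRep G l₂ t w := by
  induction l₁ with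
  | nil => rfl
  | cons v l ih =>
    rw [List.mem_cons, not_or] at h
    rw [List.cons_append, seqRep_cons_of_ne h.1, ih h.2]

theorem seqRep_map (φ : R →+* R') (l : List V) (t : V → ι → R) :
    seqRep G l (fun v i => φ (t v i)) = fun v i => φ (seqRep G l t v i) := by
  induction l with
  | nil => ext; simp [seqRep]
  | cons v l ih =>
    funext w
    by_cases h : w = v
    · subst h
      rw [seqRep_cons_self, ih, scaledProj_map, seqRep_cons_self]
    · rw [seqRep_cons_of_ne h, ih, seqRep_cons_of_ne h]

theorem seqRep_orthogonal {l : List V} (hl : l.Nodup) (t : V → ι → R) {v w : V} (hvw : v ≠ w)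
    (hadj : ¬ G.Adj v w) : seqRep G l t v ⬝ᵥ seqRep G l t w = 0 := by
  induction l with
  | nil => simp [seqRep]
  | cons u l ih =>
    rw [List.nodup_cons] at hl
    have key : ∀ w, u ≠ w → ¬ G.Adj u w →
        seqRep G (u :: l) t w ⬝ᵥ seqRep G (u :: l) t u = 0 := by
      intro w huw hw
      rw [seqRep_cons_of_ne huw.symm, seqRep_cons_self]
      by_cases hwl : w ∈ l
      · exact dotProduct_scaledProj _ _ (by simp [hwl, hw])
      · rw [seqRep_of_notMem hwl, zero_dotProduct]
    by_cases h1 : v = u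
    · subst h1
      rw [dotProduct_comm]
      exact key w hvw hadj
    · by_cases h2 : w = u
      · subst h2
        exact key v hvw.symm (fun h => hadj h.symm)
      · rw [seqRep_cons_of_ne h1, seqRep_cons_of_ne h2]
        exact ih hl.2

/-- Neither of two adjacent vertices enters the projection of the other. -/
theorem seqRep_swap {u v : V} (huv : G.Adj u v) (l : List V) (t : V → ι → R) :
    seqRep G (u :: v :: l) t = seqRep G (v :: u :: l) t := by
  have hne : u ≠ v := huv.ne
  have key : ∀ u v : V, G.Adj u v → seqRep G (u :: v :: l) t u = seqRep G (v :: u :: l) t u := by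
    intro u v huv
    rw [seqRep_cons_self, seqRep_cons_of_ne huv.ne, seqRep_cons_self]
    have : ((v :: l).toFinset.filter fun w => ¬ G.Adj u w)
        = l.toFinset.filter fun w => ¬ G.Adj u w := by
      rw [List.toFinset_cons, Finset.filter_insert, if_neg (not_not.2 huv)]
    rw [this]
    refine scaledProj_congr (fun w hw => seqRep_cons_of_ne ?_ _ _) _
    rintro rfl
    exact (Finset.mem_filter.1 hw).2 huv
  funext w
  by_cases h1 : w = u
  · subst h1; exact key w v huv
  · by_cases h2 : w = v
    · subst h2; exact (key w u huv.symm).symm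
    · rw [seqRep_cons_of_ne h1, seqRep_cons_of_ne h2, seqRep_cons_of_ne h2, seqRep_cons_of_ne h1]

/-- Parameters that are orthonormal along the list are reproduced. -/
theorem seqRep_of_orthonormal {l : List V} (hl : l.Nodup) {t : V → ι → R}
    (ht : ∀ v ∈ l, ∀ w ∈ l, t v ⬝ᵥ t w = if v = w then 1 else 0) :
    ∀ v ∈ l, seqRep G l t v = t v := by
  induction l with
  | nil => simp
  | cons u l ih =>
    rw [List.nodup_cons] at hl
    have ih' := ih hl.2 fun v hv w hw => ht v (by simp [hv]) w (by simp [hw])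
    intro v hv
    by_cases h : v = u
    · subst h
      rw [seqRep_cons_self]
      set S := l.toFinset.filter fun w => ¬ G.Adj v w
      have hS : ∀ w ∈ S, w ∈ l := fun w hw => List.mem_toFinset.1 (Finset.mem_filter.1 hw).1
      rw [scaledProj_congr (g := t) (fun w hw => ih' w (hS w hw)), scaledProj_of_orthogonal]
      · have : gramOn t S = 1 := by
          ext i j
          rw [gramOn, Matrix.of_apply, ht i (by simp [hS i i.2]) j (by simp [hS j j.2]),
            Matrix.one_apply]
          exact if_congr Subtype.ext_iff.symm rfl rfl
        rw [this, Matrix.det_one, one_smul]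
      · intro w hw
        rw [ht w (by simp [hS w hw]) v (by simp), if_neg]
        rintro rfl
        exact hl.1 (hS w hw)
    · rw [seqRep_cons_of_ne h]
      exact ih' v ((List.mem_cons.1 hv).resolve_left h)

/-- Every nondegenerate orthogonal representation is sequential, for each order. -/
theorem exists_seqRep_eq {K : Type*} [Field K] {f : V → ι → K}
    (horth : ∀ v w, v ≠ w → ¬ G.Adj v w → f v ⬝ᵥ f w = 0) {l : List V} (hl : l.Nodup)
    (hf : ∀ S ⊆ l.toFinset, (gramOn f S).det ≠ 0) :
    ∃ t : V → ι → K, ∀ v ∈ l, seqRep G l t v = f v := by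
  induction l with
  | nil => exact ⟨0, by simp⟩
  | cons u l ih =>
    rw [List.nodup_cons] at hl
    obtain ⟨t, ht⟩ := ih hl.2 fun S hS => hf S (hS.trans (by simp))
    set S := l.toFinset.filter fun w => ¬ G.Adj u w with hSdef
    have hS : ∀ w ∈ S, w ∈ l := fun w hw => List.mem_toFinset.1 (Finset.mem_filter.1 hw).1
    -- `f u` is already orthogonal to the vectors of `S`, so projecting only multiplies by the
    -- determinant, which the parameter cancels.
    refine ⟨Function.update t u ((gramOn f S).det⁻¹ • f u), fun v hv => ?_⟩
    rw [List.mem_cons] at hv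
    have hcongr := seqRep_update_of_notMem (G := G) hl.1 t ((gramOn f S).det⁻¹ • f u)
    by_cases h : v = u
    · subst h
      rw [seqRep_cons_self, hcongr, ← hSdef, Function.update_self,
        scaledProj_congr (g := f) (fun w hw => ht w (hS w hw)), scaledProj_of_orthogonal, smul_smul,
        mul_inv_cancel₀, one_smul]
      · refine hf S fun w hw => ?_
        simp [hS w hw]
      · intro w hw
        rw [dotProduct_smul, horth, smul_zero]
        · rintro rfl
          exact hl.1 (hS w hw)
        · exact fun h => (Finset.mem_filter.1 hw).2 h.symm
    · rw [seqRep_cons_of_ne h, hcongr, ht v (hv.resolve_left h)]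

end SequentialRepresentation

/-! ### Generic properties and independence of the order -/

section Genericity

open Matrix Polynomial Filter

variable {V ι : Type*}

/-- A condition on vector families that, along every polynomial curve, fails only finitely often
unless it fails identically. -/
def PolyOpen (Q : (V → ι → ℝ) → Prop) : Prop :=
  ∀ F : V → ι → ℝ[X], (∃ s : ℝ, Q fun v i => (F v i).eval s) →
    ∀ᶠ s : ℝ in cofinite, Q fun v i => (F v i).eval s

theorem PolyOpen.and {Q₁ Q₂ : (V → ι → ℝ) → Prop} (h₁ : PolyOpen Q₁) (h₂ : PolyOpen Q₂) :
    PolyOpen fun f => Q₁ f ∧ Q₂ f :=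
  fun F ⟨s, hs⟩ => (h₁ F ⟨s, hs.1⟩).and (h₂ F ⟨s, hs.2⟩)

theorem PolyOpen.forall_mem {α : Type*} {Q : α → (V → ι → ℝ) → Prop} (A : Finset α)
    (h : ∀ a ∈ A, PolyOpen (Q a)) : PolyOpen fun f => ∀ a ∈ A, Q a f :=
  fun F ⟨s, hs⟩ => (eventually_all_finset A).2 fun a ha => h a ha F ⟨s, hs a ha⟩

theorem Polynomial.eventually_eval_ne_zero {p : ℝ[X]} (h : ∃ s, p.eval s ≠ 0) :
    ∀ᶠ s in cofinite, p.eval s ≠ 0 := by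
  obtain ⟨s, hs⟩ := h
  have hp : p ≠ 0 := by rintro rfl; simp at hs
  simpa [eventually_cofinite, Polynomial.IsRoot] using Polynomial.finite_setOfPred_isRoot hp

variable [Fintype ι]

theorem polyOpen_dotProduct_ne_zero (v w : V) :
    PolyOpen fun f : V → ι → ℝ => f v ⬝ᵥ f w ≠ 0 := by
  intro F hF
  have h : ∀ s, (F v ⬝ᵥ F w).eval s
      = (fun i => (F v i).eval s) ⬝ᵥ fun i => (F w i).eval s := fun s => by
    simp [dotProduct, Polynomial.eval_finsetSum]
  simp only [← h] at hF ⊢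
  exact Polynomial.eventually_eval_ne_zero hF

variable [DecidableEq V]

theorem polyOpen_det_gramOn_ne_zero (S : Finset V) :
    PolyOpen fun f : V → ι → ℝ => (gramOn f S).det ≠ 0 := by
  intro F hF
  have h : ∀ s, (gramOn F S).det.eval s = (gramOn (fun v i => (F v i).eval s) S).det :=
    fun s => (det_gramOn_map (Polynomial.evalRingHom s) F S).symm
  simp only [← h] at hF ⊢
  exact Polynomial.eventually_eval_ne_zero hF

variable (G : SimpleGraph V) [DecidableRel G.Adj]

/-- `Q` holds for some, hence for almost every, sequential representation along `l`. -/
def HoldsGenerically (l : List V) (Q : (V → ι → ℝ) → Prop) : Prop :=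
  ∃ t, Q (seqRep G l t)

variable {G}

/-- On the line joining the two parameter families, each condition holds at one point, hence at all
but finitely many. -/
theorem HoldsGenerically.and {l : List V} {Q₁ Q₂ : (V → ι → ℝ) → Prop} (o₁ : PolyOpen Q₁)
    (o₂ : PolyOpen Q₂) (h₁ : HoldsGenerically G l Q₁) (h₂ : HoldsGenerically G l Q₂) :
    HoldsGenerically G l fun f => Q₁ f ∧ Q₂ f := by
  obtain ⟨t₁, h₁⟩ := h₁
  obtain ⟨t₂, h₂⟩ := h₂
  let T : V → ι → ℝ[X] := fun v i => C (t₁ v i) + X * C (t₂ v i - t₁ v i)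
  have key : ∀ s : ℝ, (fun v i => (seqRep G l T v i).eval s)
      = seqRep G l fun v i => (T v i).eval s :=
    fun s => (seqRep_map (Polynomial.evalRingHom s) l T).symm
  have T0 : (fun v i => (T v i).eval 0) = t₁ := by ext; simp [T]
  have T1 : (fun v i => (T v i).eval 1) = t₂ := by ext; simp [T]
  have e₁ := o₁ (seqRep G l T) ⟨0, by rw [key, T0]; exact h₁⟩
  have e₂ := o₂ (seqRep G l T) ⟨1, by rw [key, T1]; exact h₂⟩
  obtain ⟨s, hs⟩ := (e₁.and e₂).exists
  rw [key] at hs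
  exact ⟨_, hs⟩

theorem HoldsGenerically.forall_mem {α : Type*} {l : List V} {Q : α → (V → ι → ℝ) → Prop}
    (A : Finset α) (o : ∀ a ∈ A, PolyOpen (Q a)) (h : ∀ a ∈ A, HoldsGenerically G l (Q a)) :
    HoldsGenerically G l fun f => ∀ a ∈ A, Q a f := by
  classical
  induction A using Finset.induction_on with
  | empty => exact ⟨0, by simp⟩
  | insert a A _ ih =>
    simp only [Finset.forall_mem_insert] at o h ⊢
    exact h.1.and o.1 (PolyOpen.forall_mem A o.2) (ih o.2 h.2)

/-- Absorbing the parameter of the last treated vertex into the property allows induction on the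
list. -/
theorem holdsGenerically_cons_iff {v : V} {l : List V} (hv : v ∉ l) {Q : (V → ι → ℝ) → Prop} :
    HoldsGenerically G (v :: l) Q ↔ HoldsGenerically G l fun f => ∃ y, Q (Function.update f v
      (scaledProj f (l.toFinset.filter fun w => ¬ G.Adj v w) y)) := by
  constructor
  · rintro ⟨t, ht⟩
    exact ⟨t, t v, ht⟩
  · rintro ⟨t, y, ht⟩
    refine ⟨Function.update t v y, ?_⟩
    rwa [seqRep, seqRep_update_of_notMem hv, Function.update_self]

theorem PolyOpen.exists_update {Q : (V → ι → ℝ) → Prop} (h : PolyOpen Q) (v : V) (S : Finset V) :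
    PolyOpen fun f => ∃ y, Q (Function.update f v (scaledProj f S y)) := by
  rintro F ⟨s, y, hy⟩
  let F' : V → ι → ℝ[X] := Function.update F v (scaledProj F S fun i => C (y i))
  have key : ∀ s : ℝ, (fun w i => (F' w i).eval s) = Function.update (fun w i => (F w i).eval s) v
      (scaledProj (fun w i => (F w i).eval s) S y) := by
    intro s
    have := scaledProj_map (Polynomial.evalRingHom s) F S fun i => C (y i)
    simp only [Polynomial.coe_evalRingHom, Polynomial.eval_C] at this
    rw [this]
    funext w
    by_cases hw : w = v
    · subst hw; simp [F']
    · simp [F', hw]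
  refine (h F' ⟨s, by rwa [key]⟩).mono fun s' hs' => ⟨y, ?_⟩
  rwa [key] at hs'

theorem exists_orthonormal_of_card_le {l : List V} (hl : l.Nodup)
    (hcard : l.length ≤ Fintype.card ι) :
    ∃ t : V → ι → ℝ, ∀ v ∈ l, ∀ w ∈ l, t v ⬝ᵥ t w = if v = w then 1 else 0 := by
  classical
  obtain ⟨e⟩ : Nonempty (l.toFinset ↪ ι) := by
    rw [Function.Embedding.nonempty_iff_card_le, Fintype.card_coe, List.toFinset_card_of_nodup hl]
    exact hcard
  refine ⟨fun v => if h : v ∈ l.toFinset then Pi.single (e ⟨v, h⟩) 1 else 0, fun v hv w hw => ?_⟩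
  rw [← List.mem_toFinset] at hv hw
  simp only [hv, hw, dif_pos, single_dotProduct, one_mul, Pi.single_apply, e.injective.eq_iff,
    Subtype.mk.injEq]

theorem det_gramOn_ne_zero_of_orthonormal {t : V → ι → ℝ} {S : Finset V}
    (ht : ∀ v ∈ S, ∀ w ∈ S, t v ⬝ᵥ t w = if v = w then 1 else 0) : (gramOn t S).det ≠ 0 := by
  have : gramOn t S = 1 := by
    ext i j
    rw [gramOn, Matrix.of_apply, ht i i.2 j j.2, Matrix.one_apply]
    exact if_congr Subtype.ext_iff.symm rfl rfl
  simp [this]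

/-- With no more vertices than dimensions, the vectors are generically independent, and such a
representation arises in every order. -/
theorem HoldsGenerically.perm_of_length_le {l l' : List V} (hl : l.Nodup) (hp : l.Perm l')
    (hcard : l.length ≤ Fintype.card ι) {Q : (V → ι → ℝ) → Prop} (o : PolyOpen Q)
    (h : HoldsGenerically G l Q) : HoldsGenerically G l' Q := by
  have hdet : HoldsGenerically G l fun f : V → ι → ℝ =>
      ∀ S ∈ l.toFinset.powerset, (gramOn f S).det ≠ 0 := by
    obtain ⟨t, ht⟩ := exists_orthonormal_of_card_le (ι := ι) hl hcard
    refine ⟨t, fun S hS => ?_⟩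
    have hS' : ∀ v ∈ S, v ∈ l := fun v hv => List.mem_toFinset.1 (Finset.mem_powerset.1 hS hv)
    rw [gramOn_congr fun v hv => seqRep_of_orthonormal hl ht v (hS' v hv)]
    exact det_gramOn_ne_zero_of_orthonormal fun v hv w hw => ht v (hS' v hv) w (hS' w hw)
  obtain ⟨t, hQ, ht⟩ := h.and o (PolyOpen.forall_mem _ fun S _ => polyOpen_det_gramOn_ne_zero S) hdet
  have hl' := hp.nodup_iff.1 hl
  obtain ⟨t', ht'⟩ := exists_seqRep_eq (G := G) (f := seqRep G l t)
    (fun v w => seqRep_orthogonal hl t) hl' fun S hS => ht S <| by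
      rwa [Finset.mem_powerset, List.toFinset_eq_of_perm _ _ hp]
  have : seqRep G l' t' = seqRep G l t := by
    funext v
    by_cases hv : v ∈ l'
    · exact ht' v hv
    · rw [seqRep_of_notMem hv, seqRep_of_notMem fun h => hv (hp.mem_iff.1 h)]
  exact ⟨t', by rwa [this]⟩

/-- Generic properties do not depend on the order, if any two nonempty disjoint vertex sets without
edges between them have together at most as many vertices as the dimension. -/
theorem HoldsGenerically.perm
    (hG : ∀ B C : Finset V, B.Nonempty → C.Nonempty → Disjoint B C →
      (∀ b ∈ B, ∀ c ∈ C, ¬ G.Adj b c) → B.card + C.card ≤ Fintype.card ι)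
    {l l' : List V} (hl : l.Nodup) (hp : l.Perm l') {Q : (V → ι → ℝ) → Prop} (o : PolyOpen Q)
    (h : HoldsGenerically G l Q) : HoldsGenerically G l' Q := by
  induction hn : l.length using Nat.strong_induction_on generalizing l l' Q with
  | _ n ih =>
  subst hn
  by_cases hcard : l.length ≤ Fintype.card ι
  · exact h.perm_of_length_le hl hp hcard o
  have same : ∀ (v : V) (m m' : List V), (v :: m).Perm l → m.Perm m' →
      HoldsGenerically G (v :: m) Q → HoldsGenerically G (v :: m') Q := by
    intro v m m' hm hmm' hQ
    have hnd := List.nodup_cons.1 (hm.nodup_iff.2 hl)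
    rw [holdsGenerically_cons_iff hnd.1] at hQ
    rw [holdsGenerically_cons_iff (by rw [← hmm'.mem_iff]; exact hnd.1),
      ← List.toFinset_eq_of_perm _ _ hmm']
    refine ih m.length ?_ hnd.2 hmm' (o.exists_update v _) hQ rfl
    rw [← hm.length_eq]
    simp
  obtain _ | ⟨v', l₁⟩ := l'
  · rwa [List.perm_nil.1 hp] at h
  classical
  -- The heads from which `Q` transfers to the target order. `A` is closed under adjacency within
  -- `l`; were it proper, `hG` applied to `A` and its complement in `l` would contradict the length
  -- of `l`.
  let A : Finset V := l.toFinset.filter fun v => ∀ m : List V, (v :: m).Perm l →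
    HoldsGenerically G (v :: m) Q → HoldsGenerically G (v' :: l₁) Q
  have hA : ∀ v, v ∈ A ↔ v ∈ l ∧ ∀ m : List V, (v :: m).Perm l →
      HoldsGenerically G (v :: m) Q → HoldsGenerically G (v' :: l₁) Q := fun v => by simp [A]
  have hv'A : v' ∈ A := (hA v').2 ⟨hp.mem_iff.2 (by simp), fun m hm =>
    same v' m l₁ hm (List.Perm.cons_inv (hm.trans hp))⟩
  obtain _ | ⟨v, m⟩ := l
  · simp at hcard
  by_cases hv : v ∈ A
  · exact ((hA v).1 hv).2 m (List.Perm.refl _) h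
  exfalso
  have hsub : A ⊆ (v :: m).toFinset := Finset.filter_subset _ _
  have hle := hG A ((v :: m).toFinset \ A) ⟨v', hv'A⟩ ⟨v, by simp [hv]⟩ Finset.disjoint_sdiff ?_
  · rw [add_comm, Finset.card_sdiff_add_card_eq_card hsub, List.toFinset_card_of_nodup hl] at hle
    exact hcard hle
  intro b hb c hc hbc
  rw [Finset.mem_sdiff, List.mem_toFinset] at hc
  refine hc.2 ((hA c).2 ⟨hc.1, fun m₁ hm₁ hQ => ?_⟩)
  obtain ⟨hbl, hb⟩ := (hA b).1 hb
  have hbm : b ∈ m₁ := (List.mem_cons.1 (hm₁.mem_iff.2 hbl)).resolve_left hbc.ne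
  have hperm := List.perm_cons_erase hbm
  -- Bring `b` next to `c` by `same`, then swap the two adjacent vertices.
  refine hb (c :: m₁.erase b) ?_ ?_
  · exact (List.Perm.swap _ _ _).trans ((hperm.symm.cons c).trans hm₁)
  · obtain ⟨t, ht⟩ := same c _ _ hm₁ hperm hQ
    exact ⟨t, by rwa [seqRep_swap hbc]⟩

end Genericity

/-! ### Faithful representations in general position -/

section Existence

open Matrix

variable {V : Type*} [Fintype V]

/-- A graph in which any two nonempty disjoint vertex sets without edges between them have together
at most `k` vertices has an orthogonal representation in dimension `k` that is faithful and in
general position. -/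
theorem SimpleGraph.exists_generalPosition_orthogonalRepresentation [DecidableEq V]
    (G : SimpleGraph V) {k : ℕ} (hk : 0 < k)
    (hG : ∀ B C : Finset V, B.Nonempty → C.Nonempty → Disjoint B C →
      (∀ b ∈ B, ∀ c ∈ C, ¬ G.Adj b c) → B.card + C.card ≤ k) :
    ∃ f : V → Fin k → ℝ, (∀ v w, v ≠ w → (f v ⬝ᵥ f w ≠ 0 ↔ G.Adj v w)) ∧
      ∀ T : Finset V, T.card ≤ k → (gramOn f T).det ≠ 0 := by
  classical
  set l := (Finset.univ : Finset V).toList with hldef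
  have hl : l.Nodup := Finset.nodup_toList _
  have reorder : ∀ m : List V, m.Nodup → ∃ r : List V, (r ++ m).Perm l ∧ (r ++ m).Nodup := by
    intro m hm
    have hnd : ((Finset.univ \ m.toFinset).toList ++ m).Nodup :=
      List.nodup_append.2 ⟨Finset.nodup_toList _, hm, fun a ha b hb => by
        rintro rfl; simp [hb] at ha⟩
    refine ⟨_, (List.perm_ext_iff_of_nodup hnd hl).2 fun a => ?_, hnd⟩
    simp [hldef, em']
  have hG' : ∀ B C : Finset V, B.Nonempty → C.Nonempty → Disjoint B C →
      (∀ b ∈ B, ∀ c ∈ C, ¬ G.Adj b c) → B.card + C.card ≤ Fintype.card (Fin k) := by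
    simpa using hG
  have hgram : HoldsGenerically G l fun f : V → Fin k → ℝ =>
      ∀ T ∈ (Finset.univ : Finset V).powerset.filter (·.card ≤ k), (gramOn f T).det ≠ 0 := by
    refine HoldsGenerically.forall_mem _ (fun T _ => polyOpen_det_gramOn_ne_zero T) fun T hT => ?_
    obtain ⟨r, hr, hnd⟩ := reorder T.toList T.nodup_toList
    refine HoldsGenerically.perm hG' hnd hr (polyOpen_det_gramOn_ne_zero T) ?_
    obtain ⟨t, ht⟩ := exists_orthonormal_of_card_le (ι := Fin k) T.nodup_toList
      (by simpa using hT)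
    have hdisj := (List.nodup_append.1 hnd).2.2
    refine ⟨t, ?_⟩
    beta_reduce
    rw [gramOn_congr (g := t) fun v hv => ?_]
    · exact det_gramOn_ne_zero_of_orthonormal fun v hv w hw => ht v (by simpa) w (by simpa)
    · have hvT : v ∈ T.toList := by simpa
      rw [seqRep_append_of_notMem fun h => hdisj v h v hvT rfl]
      exact seqRep_of_orthonormal T.nodup_toList ht v hvT
  have hedge : HoldsGenerically G l fun f : V → Fin k → ℝ =>
      ∀ p ∈ (Finset.univ : Finset (V × V)).filter (fun p => G.Adj p.1 p.2),
        f p.1 ⬝ᵥ f p.2 ≠ 0 := by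
    refine HoldsGenerically.forall_mem _ (fun p _ => polyOpen_dotProduct_ne_zero p.1 p.2) ?_
    rintro ⟨v, w⟩ hvw
    replace hvw : G.Adj v w := by simpa using hvw
    obtain ⟨r, hr, hnd⟩ := reorder [v, w] (by simp [hvw.ne])
    refine HoldsGenerically.perm hG' hnd hr (polyOpen_dotProduct_ne_zero v w) ?_
    have hdisj := (List.nodup_append.1 hnd).2.2
    -- Treated first, the adjacent `v` and `w` are not projected at all, so both may receive the
    -- same unit vector.
    refine ⟨fun _ => Pi.single ⟨0, hk⟩ 1, ?_⟩
    have hfilter : ([w].toFinset.filter fun x => ¬ G.Adj v x) = ∅ := by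
      simp [Finset.filter_singleton, hvw]
    beta_reduce
    rw [seqRep_append_of_notMem fun h => hdisj v h v (by simp) rfl,
      seqRep_append_of_notMem fun h => hdisj w h w (by simp) rfl, seqRep_cons_self, hfilter,
      seqRep_cons_of_ne hvw.ne.symm, seqRep_cons_self]
    have hnil : (([] : List V).toFinset.filter fun x => ¬ G.Adj w x) = ∅ := rfl
    rw [hnil, scaledProj_empty, scaledProj_empty]
    simp
  obtain ⟨t, h₁, h₂⟩ := hgram.and
    (PolyOpen.forall_mem _ fun T _ => polyOpen_det_gramOn_ne_zero T)
    (PolyOpen.forall_mem _ fun p _ => polyOpen_dotProduct_ne_zero p.1 p.2) hedge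
  refine ⟨seqRep G l t, fun v w hvw => ⟨fun h => ?_, fun h => h₂ (v, w) (by simpa using h)⟩,
    fun T hT => h₁ T (by simpa using hT)⟩
  by_contra hadj
  exact h (seqRep_orthogonal hl t hvw hadj)

end Existence

/-! ### Spark, rank and zero blocks of symmetric matrices -/

section Spark

open Matrix

variable {V : Type*} [Fintype V]

theorem Matrix.card_le_rank_of_linearIndepOn {A : Matrix V V ℝ} {T : Finset V}
    (h : LinearIndepOn ℝ A.col (T : Set V)) : T.card ≤ A.rank := by
  have hT : Module.finrank ℝ (Submodule.span ℝ (A.col '' (T : Set V))) = T.card := by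
    rw [Set.image_eq_range]
    exact (finrank_span_eq_card h).trans (Fintype.card_coe T)
  rw [← hT, A.rank_eq_finrank_span_cols]
  exact Submodule.finrank_mono (Submodule.span_mono (Set.image_subset_range _ _))

theorem Matrix.span_col_image_eq {A : Matrix V V ℝ} {T : Finset V}
    (h : LinearIndepOn ℝ A.col (T : Set V)) (hT : T.card = A.rank) :
    Submodule.span ℝ (A.col '' (T : Set V)) = Submodule.span ℝ (Set.range A.col) := by
  refine Submodule.eq_of_le_of_finrank_eq (Submodule.span_mono (Set.image_subset_range _ _)) ?_
  rw [← A.rank_eq_finrank_span_cols, ← hT, Set.image_eq_range]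
  exact (finrank_span_eq_card h).trans (Fintype.card_coe T)

theorem Matrix.spark_eq_of_rank {A : Matrix V V ℝ} {k : ℕ} (hk : A.rank = k)
    (h : ∀ T : Finset V, T.card ≤ k → LinearIndepOn ℝ A.col (T : Set V)) : A.spark = k + 1 := by
  classical
  have hrank : k ≤ Fintype.card V := hk ▸ A.rank_le_card_width
  by_cases hA : LinearIndependent ℝ A.col
  · rw [spark, if_pos hA, ← hk, ← A.rank_transpose, LinearIndependent.rank_matrix (M := Aᵀ) hA]
  · rw [spark, if_neg hA]
    have hlt : k < Fintype.card V := by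
      refine lt_of_le_of_ne hrank fun he => hA ?_
      have := h Finset.univ (by rw [Finset.card_univ, he])
      rwa [Finset.coe_univ, linearIndepOn_univ_iff] at this
    obtain ⟨T, hT⟩ := Finset.exists_subset_card_eq (s := (Finset.univ : Finset V))
      (n := k + 1) (by rw [Finset.card_univ]; omega)
    refine le_antisymm (Nat.sInf_le ⟨T, hT.2, fun hind => ?_⟩) ?_
    · have := card_le_rank_of_linearIndepOn hind
      omega
    · refine le_csInf ⟨_, Finset.univ, rfl, ?_⟩ ?_
      · rwa [Finset.coe_univ, linearIndepOn_univ_iff]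
      · rintro s ⟨T, rfl, hT⟩
        by_contra hlt
        exact hT (h T (by omega))

theorem Matrix.linearIndepOn_of_spark {A : Matrix V V ℝ} {k : ℕ} (h : A.spark = k + 1)
    {T : Finset V} (hT : T.card ≤ k) : LinearIndepOn ℝ A.col (T : Set V) := by
  classical
  by_cases hA : LinearIndependent ℝ A.col
  · exact hA.linearIndepOn _
  · rw [spark, if_neg hA] at h
    by_contra hT'
    have := Nat.sInf_le (s := {s : ℕ | ∃ T : Finset V, T.card = s ∧
      ¬ LinearIndepOn ℝ A.col (T : Set V)}) ⟨T, rfl, hT'⟩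
    omega

/-- A vector of the column space of a symmetric matrix vanishes if it vanishes at the indices of
columns that span the column space. -/
theorem Matrix.IsSymm.mulVec_eq_zero {A : Matrix V V ℝ} (hA : A.IsSymm) {T : Finset V}
    (hT : Submodule.span ℝ (A.col '' (T : Set V)) = Submodule.span ℝ (Set.range A.col))
    {w : V → ℝ} (hw : ∀ i ∈ T, (A *ᵥ w) i = 0) : A *ᵥ w = 0 := by
  have hcol : ∀ i, (A *ᵥ w) i = A.col i ⬝ᵥ w := fun i => by
    simp only [mulVec, dotProduct, col_apply]
    exact Finset.sum_congr rfl fun j _ => by rw [hA.apply]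
  have key : ∀ y ∈ Submodule.span ℝ (A.col '' (T : Set V)), y ⬝ᵥ w = 0 := by
    intro y hy
    induction hy using Submodule.span_induction with
    | mem y hy =>
      obtain ⟨i, hi, rfl⟩ := hy
      rw [← hcol]
      exact hw i hi
    | zero => exact zero_dotProduct w
    | add y z _ _ hy hz => rw [add_dotProduct, hy, hz, add_zero]
    | smul a y _ hy => rw [smul_dotProduct, hy, smul_zero]
  ext i
  rw [hcol]
  exact key _ (hT ▸ Submodule.subset_span ⟨i, rfl⟩)

theorem Matrix.IsSymm.card_add_card_le_of_spark {A : Matrix V V ℝ} (hA : A.IsSymm) {k : ℕ}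
    (hk : 0 < k) (hrank : A.rank = k) (hspark : A.spark = k + 1) {B C : Finset V}
    (hB : B.Nonempty) (hC : C.Nonempty) (hdisj : Disjoint B C)
    (hBC : ∀ b ∈ B, ∀ c ∈ C, A b c = 0) : B.card + C.card ≤ k := by
  classical
  by_contra hcard
  obtain ⟨b, hb⟩ := hB
  obtain ⟨c, hc⟩ := hC
  have hbc : b ≠ c := fun h => Finset.disjoint_left.1 hdisj hb (h ▸ hc)
  -- Size `k + 1` exceeds the rank, so the columns of `T` are dependent; containing `b` and `c`
  -- keeps `T ∩ B` and `T \ B` at size at most `k`.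
  obtain ⟨T, hbcT, hTBC, hT⟩ := Finset.exists_subsuperset_card_eq (s := {b, c}) (t := B ∪ C)
    (n := k + 1) (by simp [Finset.insert_subset_iff, hb, hc])
    (by rw [Finset.card_pair hbc]; omega) (by rw [Finset.card_union_of_disjoint hdisj]; omega)
  have hbT : b ∈ T := hbcT (by simp)
  have hcT : c ∈ T := hbcT (by simp)
  have hspan : Submodule.span ℝ (A.col '' (T : Set V)) = Submodule.span ℝ (Set.range A.col) := by
    have hTb : (T.erase b).card = k := by rw [Finset.card_erase_of_mem hbT, hT]; rfl
    have h1 := span_col_image_eq (linearIndepOn_of_spark hspark hTb.le) (hTb.trans hrank.symm)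
    refine le_antisymm (Submodule.span_mono (Set.image_subset_range _ _)) ?_
    rw [← h1]
    exact Submodule.span_mono (Set.image_mono (by simp))
  have hdep : ¬ LinearIndepOn ℝ A.col (T : Set V) := fun h => by
    have := card_le_rank_of_linearIndepOn h
    omega
  refine hdep (linearIndepOn_finset_iff.2 fun x hx => ?_)
  have hTB : (T ∩ B).card ≤ k := by
    have : T ∩ B ⊆ T.erase c := fun i hi => by
      rw [Finset.mem_inter] at hi
      exact Finset.mem_erase.2 ⟨fun h => Finset.disjoint_left.1 hdisj hi.2 (h ▸ hc), hi.1⟩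
    have := Finset.card_le_card this
    rwa [Finset.card_erase_of_mem hcT, hT] at this
  have hTC : (T \ B).card ≤ k := by
    have : T \ B ⊆ T.erase b := fun i hi => by
      rw [Finset.mem_sdiff] at hi
      exact Finset.mem_erase.2 ⟨fun h => hi.2 (h ▸ hb), hi.1⟩
    have := Finset.card_le_card this
    rwa [Finset.card_erase_of_mem hbT, hT] at this
  have hmem : ∀ i ∈ T \ B, i ∈ C := fun i hi => by
    rw [Finset.mem_sdiff] at hi
    exact (Finset.mem_union.1 (hTBC hi.1)).resolve_left hi.2
  have hsplit : ∑ i ∈ T \ B, x i • A.col i + ∑ i ∈ T ∩ B, x i • A.col i = 0 := by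
    rw [← hx, ← Finset.sum_union (Finset.disjoint_sdiff_inter T B), Finset.sdiff_union_inter]
  have happ : ∀ (S : Finset V) (i : V), (∑ j ∈ S, x j • A.col j) i = ∑ j ∈ S, x j * A i j :=
    fun S i => by simp [Finset.sum_apply]
  have hy : A *ᵥ (fun j => if j ∈ T ∩ B then x j else 0) = ∑ i ∈ T ∩ B, x i • A.col i := by
    ext i
    rw [happ, mulVec, dotProduct]
    simp only [mul_ite, mul_zero, Finset.sum_ite_mem, Finset.univ_inter]
    exact Finset.sum_congr rfl fun j _ => mul_comm _ _
  -- It suffices to check rows in `T`: in rows of `B` the other half of the relation vanishes, in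
  -- rows of `C` this half does.
  have hzero : ∑ i ∈ T ∩ B, x i • A.col i = 0 := by
    rw [← hy]
    refine hA.mulVec_eq_zero hspan fun i hi => ?_
    rw [hy]
    by_cases hiB : i ∈ B
    · have := congrFun hsplit i
      rw [Pi.add_apply, happ (T \ B), Finset.sum_eq_zero, zero_add] at this
      · exact this
      · exact fun j hj => by rw [hBC i hiB j (hmem j hj), mul_zero]
    · rw [happ]
      refine Finset.sum_eq_zero fun j hj => ?_
      rw [hA.apply, hBC j (Finset.mem_inter.1 hj).2 i (hmem i (Finset.mem_sdiff.2 ⟨hi, hiB⟩)),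
        mul_zero]
  rw [hzero, add_zero] at hsplit
  intro i hi
  by_cases hiB : i ∈ B
  · exact linearIndepOn_finset_iff.1 (linearIndepOn_of_spark hspark hTB) x hzero i
      (Finset.mem_inter.2 ⟨hi, hiB⟩)
  · exact linearIndepOn_finset_iff.1 (linearIndepOn_of_spark hspark hTC) x hsplit i
      (Finset.mem_sdiff.2 ⟨hi, hiB⟩)

end Spark

/-! ### Vertex connectivity and the two implications -/

namespace SimpleGraph

open Matrix

variable {V : Type*} [Fintype V] {G : SimpleGraph V}

theorem IsCutSet.card_lt {S : Finset V} (hS : G.IsCutSet S) : S.card < Fintype.card V := by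
  simp only [IsCutSet, Preconnected, not_forall] at hS
  obtain ⟨x, -⟩ := hS
  exact Finset.card_lt_univ_of_notMem fun h => x.2 (Finset.mem_coe.2 h)

theorem vertexConnectivity_le_card_of_isCutSet {S : Finset V} (hS : G.IsCutSet S) :
    G.vertexConnectivity ≤ S.card := by
  rw [vertexConnectivity, if_pos ⟨S, hS⟩]
  exact Nat.sInf_le ⟨S, hS, rfl⟩

theorem vertexConnectivity_lt_card [Nonempty V] (G : SimpleGraph V) :
    G.vertexConnectivity < Fintype.card V := by
  by_cases h : ∃ S : Finset V, G.IsCutSet S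
  · obtain ⟨S, hS⟩ := h
    exact (vertexConnectivity_le_card_of_isCutSet hS).trans_lt hS.card_lt
  · rw [vertexConnectivity, if_neg h]
    exact Nat.sub_lt Fintype.card_pos one_pos

theorem isCutSet_compl_union [DecidableEq V] {B C : Finset V} (hB : B.Nonempty) (hC : C.Nonempty)
    (hdisj : Disjoint B C) (hBC : ∀ b ∈ B, ∀ c ∈ C, ¬ G.Adj b c) : G.IsCutSet (B ∪ C)ᶜ := by
  intro hpre
  obtain ⟨b, hb⟩ := hB
  obtain ⟨c, hc⟩ := hC
  obtain ⟨p⟩ := hpre ⟨b, by simp [hb]⟩ ⟨c, by simp [hc]⟩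
  have key : ∀ {x y : (((B ∪ C)ᶜ : Finset V) : Set V)ᶜ.Elem},
      (G.induce ((((B ∪ C)ᶜ : Finset V) : Set V)ᶜ)).Walk x y → x.1 ∈ B → y.1 ∈ B := by
    intro x y p
    induction p with
    | nil => exact id
    | @cons u v w h _ ih =>
      intro hu
      refine ih ?_
      have hv : v.1 ∈ B ∪ C := by
        have := v.2
        simpa only [Finset.coe_compl, compl_compl, Finset.mem_coe] using this
      exact (Finset.mem_union.1 hv).resolve_right fun hvC => hBC _ hu _ hvC h
  exact Finset.disjoint_left.1 hdisj (key p hb) hc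

theorem isVertexConnected_iff_forall_card_add_card_le {k : ℕ} (hk : 0 < k)
    (hkV : k ≤ Fintype.card V) :
    G.IsVertexConnected (Fintype.card V - k) ↔
      ∀ B C : Finset V, B.Nonempty → C.Nonempty → Disjoint B C →
        (∀ b ∈ B, ∀ c ∈ C, ¬ G.Adj b c) → B.card + C.card ≤ k := by
  classical
  constructor
  · intro h B C hB hC hdisj hBC
    have h1 := le_trans h
      (vertexConnectivity_le_card_of_isCutSet (isCutSet_compl_union hB hC hdisj hBC))
    have h2 := Finset.card_le_univ (B ∪ C)
    rw [Finset.card_compl, Finset.card_union_of_disjoint hdisj] at h1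
    rw [Finset.card_union_of_disjoint hdisj] at h2
    omega
  · intro h
    by_cases hcut : ∃ S : Finset V, G.IsCutSet S
    · rw [IsVertexConnected, vertexConnectivity, if_pos hcut]
      obtain ⟨S₀, hS₀⟩ := hcut
      refine le_csInf ⟨_, S₀, hS₀, rfl⟩ ?_
      rintro _ ⟨S, hS, rfl⟩
      simp only [IsCutSet, Preconnected, not_forall] at hS
      obtain ⟨x, y, hxy⟩ := hS
      -- The component of `x` after deleting `S`; the remaining vertices outside `S` serve as `C`.
      let B : Finset V := Finset.univ.filter fun v =>
        ∃ hv : v ∈ ((S : Set V)ᶜ), (G.induce ((S : Set V)ᶜ)).Reachable x ⟨v, hv⟩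
      have hB : ∀ v, v ∈ B ↔
          ∃ hv : v ∈ ((S : Set V)ᶜ), (G.induce ((S : Set V)ᶜ)).Reachable x ⟨v, hv⟩ := by
        simp [B]
      have hsub : B ⊆ Sᶜ := fun v hv => by
        obtain ⟨hv, -⟩ := (hB v).1 hv
        simpa using hv
      have hle := h B (Sᶜ \ B) ⟨x, (hB _).2 ⟨x.2, Reachable.refl _⟩⟩
        ⟨y, Finset.mem_sdiff.2 ⟨Finset.mem_compl.2 fun hy => y.2 (Finset.mem_coe.2 hy), fun hy => hxy ((hB _).1 hy).2⟩⟩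
        Finset.disjoint_sdiff ?_
      · rw [add_comm, Finset.card_sdiff_add_card_eq_card hsub, Finset.card_compl] at hle
        omega
      · intro b hb c hc hbc
        rw [Finset.mem_sdiff] at hc
        obtain ⟨hbS, hb⟩ := (hB b).1 hb
        have hcS : c ∈ ((S : Set V)ᶜ) := by simpa using hc.1
        refine hc.2 ((hB c).2 ⟨hcS, hb.trans (Adj.reachable ?_)⟩)
        exact hbc
    · rw [IsVertexConnected, vertexConnectivity, if_neg hcut]
      omega

theorem isVertexConnected_of_spark (hG : G ≠ ⊥) {A : Matrix V V ℝ} (hA : A ∈ G.symmMatrices)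
    (hspark : A.spark = A.rank + 1) : G.IsVertexConnected (Fintype.card V - A.rank) := by
  have hpos : 0 < A.rank := by
    obtain ⟨v, w, hvw⟩ := SimpleGraph.ne_bot_iff_exists_adj.1 hG
    refine lt_of_lt_of_le ?_ (Matrix.card_le_rank_of_linearIndepOn (T := {w}) ?_)
    · simp
    · rw [Finset.coe_singleton, linearIndepOn_singleton_iff]
      exact fun h => (hA.2 v w hvw.ne).2 hvw (congrFun h v)
  rw [isVertexConnected_iff_forall_card_add_card_le hpos A.rank_le_card_width]
  intro B C hB hC hdisj hBC
  refine hA.1.card_add_card_le_of_spark hpos rfl hspark hB hC hdisj fun b hb c hc => ?_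
  by_contra h
  exact hBC b hb c hc ((hA.2 b c fun he => Finset.disjoint_left.1 hdisj hb (he ▸ hc)).1 h)

theorem exists_posSemidef_of_isVertexConnected [Nonempty V] {k : ℕ} (hk : k ≤ Fintype.card V)
    (h : G.IsVertexConnected (Fintype.card V - k)) :
    ∃ A ∈ G.symmMatrices, A.PosSemidef ∧ A.rank = k ∧ A.spark = k + 1 := by
  classical
  have hpos : 0 < k := by
    have := lt_of_le_of_lt h G.vertexConnectivity_lt_card
    omega
  obtain ⟨f, hadj, hdet⟩ := G.exists_generalPosition_orthogonalRepresentation hpos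
    ((isVertexConnected_iff_forall_card_add_card_le hpos hk).1 h)
  let F : Matrix V (Fin k) ℝ := Matrix.of f
  have hF : ∀ i j, (F * Fᵀ) i j = f i ⬝ᵥ f j := fun i j => rfl
  have hind : ∀ T : Finset V, T.card ≤ k → LinearIndepOn ℝ (F * Fᵀ).col (T : Set V) := by
    intro T hT
    have hunit : IsUnit (gramOn f T) := by
      rw [Matrix.isUnit_iff_isUnit_det]
      exact (hdet T hT).isUnit
    have hcols := Matrix.linearIndependent_cols_of_isUnit hunit
    -- Restricted to the rows in `T`, these columns are those of the nonsingular `gramOn f T`.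
    refine LinearIndependent.of_comp (LinearMap.funLeft ℝ ℝ ((↑) : T → V)) ?_
    exact hcols
  have hrank : (F * Fᵀ).rank = k := by
    refine le_antisymm ?_ ?_
    · exact (Matrix.rank_mul_le_left _ _).trans ((Matrix.rank_le_card_width F).trans_eq (by simp))
    · obtain ⟨T, -, hT⟩ := Finset.exists_subset_card_eq (s := (Finset.univ : Finset V)) hk
      exact hT.symm.le.trans (Matrix.card_le_rank_of_linearIndepOn (hind T hT.le))
  refine ⟨F * Fᵀ, ⟨?_, fun i j hij => by rw [hF]; exact hadj i j hij⟩, ?_, hrank,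
    Matrix.spark_eq_of_rank hrank hind⟩
  · rw [Matrix.IsSymm, Matrix.transpose_mul, Matrix.transpose_transpose]
  · simpa using Matrix.posSemidef_self_mul_conjTranspose F

end SimpleGraph

theorem mainTheorem4 {V : Type*} [Fintype V] (G : SimpleGraph V) (hG : G ≠ ⊥) :
    (∀ k : ℕ, k ≤ Fintype.card V →
      (G.IsVertexConnected (Fintype.card V - k) ↔
        ∃ A ∈ G.symmMatrices, A.rank = k ∧ A.spark = k + 1)) ∧
    (G.mfsr : ℤ) = (Fintype.card V : ℤ) - (G.vertexConnectivity : ℤ) ∧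
    (G.mfsrPos : ℤ) = (Fintype.card V : ℤ) - (G.vertexConnectivity : ℤ) := by
  have hV : Nonempty V := by
    obtain ⟨v, -⟩ := SimpleGraph.ne_bot_iff_exists_adj.1 hG
    exact ⟨v⟩
  have hlt := G.vertexConnectivity_lt_card
  obtain ⟨A, hA, hpos, hrank, hspark⟩ := SimpleGraph.exists_posSemidef_of_isVertexConnected
    (G := G) (k := Fintype.card V - G.vertexConnectivity) (Nat.sub_le _ _)
    (by rw [SimpleGraph.IsVertexConnected]; omega)
  have hbound : ∀ A ∈ G.symmMatrices, A.spark = A.rank + 1 →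
      Fintype.card V - G.vertexConnectivity ≤ A.rank := fun A hA hs => by
    have := SimpleGraph.isVertexConnected_of_spark hG hA hs
    rw [SimpleGraph.IsVertexConnected] at this
    omega
  refine ⟨fun k hk => ⟨fun h => ?_, ?_⟩, ?_, ?_⟩
  · obtain ⟨A, hA, -, h⟩ := SimpleGraph.exists_posSemidef_of_isVertexConnected hk h
    exact ⟨A, hA, h⟩
  · rintro ⟨A, hA, rfl, hs⟩
    exact SimpleGraph.isVertexConnected_of_spark hG hA hs
  · rw [← Nat.cast_sub hlt.le, Nat.cast_inj]
    refine le_antisymm (Nat.sInf_le ⟨A, hA, by rw [hrank, hspark], hrank⟩)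
      (le_csInf ⟨_, A, hA, by rw [hrank, hspark], hrank⟩ ?_)
    rintro _ ⟨A, hA, hs, rfl⟩
    exact hbound A hA hs
  · rw [← Nat.cast_sub hlt.le, Nat.cast_inj]
    refine le_antisymm (Nat.sInf_le ⟨A, hA, hpos, by rw [hrank, hspark], hrank⟩)
      (le_csInf ⟨_, A, hA, hpos, by rw [hrank, hspark], hrank⟩ ?_)
    rintro _ ⟨A, hA, -, hs, rfl⟩
    exact hbound A hA hs
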